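/- Notation. Let $d\ge 0$ be an integer, let $\langle z,w\rangle_2=\sum_{i=1}^d z_i\overline{w_i}$ be the Hermitian inner product on $\mathbb{C}^d$ with norm $|\cdot|$, and let $\mathbb{S}^{2d-1}=\{\eta\in\mathbb{C}^d:|\eta|=1\}$. For multi-indices $\alpha\in\mathbb{N}^d$ put $|\alpha|=\sum_i\alpha_i$ and $\alpha!=\prod_i\alpha_i!$. For polynomials $P=\sum_\alpha p_\alpha z^\alpha$ and $Q=\sum_\alpha q_\alpha z^\alpha$ in $\mathbb{C}[z_1,\dots,z_d]$ let $\langle P,Q\rangle_a=\sum_\alpha\alpha!\,p_\alpha\overline{q_\alpha}$ be the apolar inner product, $\|P\|_a=\sqrt{\langle P,P\rangle_a}$ the apolar norm, and $P^*=\sum_\alpha\overline{p_\alpha}z^\alpha$. The Khavinson–Shapiro exponent $l(P)$ is the largest integer $l\ge 0$ for which there is a constant $K>0$ with $\|Pq\|_a\ge K\,m^{l/2}\|q\|_a$ for all $m\ge 0$ and all homogeneous polynomials $q$ of degree $m$ (with $0^0=1$). The zero polynomial counts as homogeneous of every degree. Theorem. Let $P\in\mathbb{C}[z_1,\dots,z_d]$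 be a non-zero homogeneous polynomial of degree $k\ge 2$ and let $1\le\rho<k$ be an integer. (1) If the polynomials $\partial^\alpha P$ with $|\alpha|=\rho$ have no common zero in $\mathbb{C}^d\setminus\{0\}$, then, with $$C_1=k^{-\rho}\binom{d+\rho-1}{\rho}^{-1/2}\min_{\eta\in\mathbb{S}^{2d-1}}\Big(\sum_{|\alpha|=\rho}|\partial^\alpha P(\eta)|^2\Big)^{1/2},$$ one has $C_1>0$ and, for all $m\ge 0$ and all homogeneous polynomials $f$ of degree $m$, $$\|P f\|_a\ge C_1\,(m+d)^{(k-\rho)/2}\,\|f\|_a .$$ (2) If $c\in\mathbb{C}^d$ satisfies $|c|=1$ and $\partial^\alpha P(c)=0$ for all $|\alpha|=\rho$, then, with $$C_2=\Big(\sum_{\rho<|\alpha|\le k}\frac{|(\partial^\alpha P^*)(\overline c)|^2}{\alpha!}\Big)^{1/2},$$ one has, for all $m\ge k$, $$\|P(z)\,\langle z,c\rangle_2^m\|_a\le C_2\,m^{(k-\rho-1)/2}\,\|\langle z,c\rangle_2^m\|_a .$$ (3) Consequently $l(P)$ exists, and $l(P)\ge k-\rho$ holds if and only if the polynomials $\partial^\alpha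 P$ with $|\alpha|=\rho$ have no common zero in $\mathbb{C}^d\setminus\{0\}$. -/

import Mathlib

open MvPolynomial
open scoped ComplexConjugate Nat

noncomputable section

/-- The finite set of multi-indices `α ∈ ℕ^d` with `|α| = α₁ + ⋯ + α_d = j`. -/
def multiIndices (d j : ℕ) : Finset (Fin d →₀ ℕ) :=
  Finset.finsuppAntidiag Finset.univ j

/-- `α! = α₁! ⋯ α_d!`. -/
def multiFactorial {d : ℕ} (α : Fin d →₀ ℕ) : ℕ := ∏ i, (α i)!

/-- The partial derivative `∂^α P = ∂₁^{α₁} ⋯ ∂_d^{α_d} P` of a complex polynomial. -/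
def partialDeriv {d : ℕ} (α : Fin d →₀ ℕ) (P : MvPolynomial (Fin d) ℂ) :
    MvPolynomial (Fin d) ℂ :=
  (List.finRange d).foldr (fun i Q => (⇑(pderiv i))^[α i] Q) P

/-- The value `P(c)` of a complex polynomial at a point of `ℂ^d` (with its Euclidean norm). -/
def evalAt {d : ℕ} (c : EuclideanSpace ℂ (Fin d)) (P : MvPolynomial (Fin d) ℂ) : ℂ :=
  eval (fun i => c i) P

/-- The polynomial `P^*`: the coefficients of `P` are conjugated. -/
def conjPoly {d : ℕ} (P : MvPolynomial (Fin d) ℂ) : MvPolynomial (Fin d) ℂ :=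
  map (starRingEnd ℂ) P

/-- The coordinatewise conjugate of a point of `ℂ^d`. -/
def conjPoint {d : ℕ} (c : EuclideanSpace ℂ (Fin d)) : EuclideanSpace ℂ (Fin d) :=
  WithLp.toLp 2 (fun i => conj (c i))

/-- The linear form `z ↦ ⟨z, c⟩ = ∑ z_i conj(c_i)`, as a polynomial in `z`. -/
def innerPoly {d : ℕ} (c : EuclideanSpace ℂ (Fin d)) : MvPolynomial (Fin d) ℂ :=
  ∑ i, C (conj (c i)) * X i

/-- The apolar inner product `⟨P, Q⟩_a = ∑_α α! p_α conj(q_α)`; the terms with `p_α = 0` vanish. -/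
def apolarInner {d : ℕ} (P Q : MvPolynomial (Fin d) ℂ) : ℂ :=
  ∑ α ∈ P.support, (multiFactorial α : ℂ) * coeff α P * conj (coeff α Q)

/-- The apolar norm `‖f‖_a = √⟨f, f⟩_a`. -/
def apolarNorm {d : ℕ} (f : MvPolynomial (Fin d) ℂ) : ℝ :=
  √(apolarInner f f).re

/-- `c` is a common zero of all derivatives `∂^α P` with `|α| = ρ`. -/
def IsCommonZero {d : ℕ} (P : MvPolynomial (Fin d) ℂ) (ρ : ℕ)
    (c : EuclideanSpace ℂ (Fin d)) : Prop :=
  ∀ α ∈ multiIndices d ρ, evalAt c (partialDeriv α P) = 0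

/-- `(∑_{|α| = ρ} |∂^α P(η)|²)^{1/2}`. -/
def derivSize {d : ℕ} (P : MvPolynomial (Fin d) ℂ) (ρ : ℕ)
    (η : EuclideanSpace ℂ (Fin d)) : ℝ :=
  √(∑ α ∈ multiIndices d ρ, ‖evalAt η (partialDeriv α P)‖ ^ 2)

/-- `(∑_{ρ < |α| ≤ k} |∂^α P^*(conj c)|² / α!)^{1/2}`. -/
def upperConst {d : ℕ} (P : MvPolynomial (Fin d) ℂ) (k ρ : ℕ)
    (c : EuclideanSpace ℂ (Fin d)) : ℝ :=
  √(∑ j ∈ Finset.Ioc ρ k, ∑ α ∈ multiIndices d j,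
    ‖evalAt (conjPoint c) (partialDeriv α (conjPoly P))‖ ^ 2 / (multiFactorial α : ℝ))

/-- `‖P q_m‖_a ≥ K m^{l/2} ‖q_m‖_a` for all homogeneous `q_m` of every degree `m`,
with a constant `K > 0` that depends on `P` only. -/
def KhavinsonShapiroBound {d : ℕ} (P : MvPolynomial (Fin d) ℂ) (l : ℕ) : Prop :=
  ∃ K : ℝ, 0 < K ∧ ∀ (m : ℕ) (q : MvPolynomial (Fin d) ℂ), q.IsHomogeneous m →
    K * (m : ℝ) ^ ((l : ℝ) / 2) * apolarNorm q ≤ apolarNorm (P * q)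

/-- `l` is the Khavinson-Shapiro exponent of `P`: the largest `l ∈ ℕ` for which the bound holds. -/
def IsKhavinsonShapiroExponent {d : ℕ} (P : MvPolynomial (Fin d) ℂ) (l : ℕ) : Prop :=
  IsGreatest {l : ℕ | KhavinsonShapiroBound P l} l

end

/-! ### Multi-indices -/

/-! Everything rests on one identity. Multiplication by `P` is adjoint to `P^*(D)` for the apolar
product (`apolarInner_mul_left`); with the Leibniz rule `diffOp_mul` this turns `‖P f‖²` into the
sum over `α` of `‖(∂^α P^*)(D) f‖² / α!` (`apolarNorm_mul_sq`).

Lower bound. Comparing the expansions for `P` and for its first derivatives gives `‖∂^α P · f‖² ≤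
k^|α| ‖P f‖²`. The apolar norm is also the `L²` norm for the Gaussian measure on `ℂ^d`
(`integral_gauss_norm_sq`), so pointwise lower bounds on `∑ |∂^α P|²` can be integrated. By
homogeneity and compactness of the sphere this sum is at least `μ² |z|^(2(k-ρ))` with `μ > 0`, and
each factor `|z|²` contributes at least `m + d`, because `∑ ‖z_i f‖² = (m + d) ‖f‖²`.

Upper bound. A constant coefficient operator maps a power of `⟨z, c⟩` to a multiple of a lower
power, so for `f = ⟨z, c⟩^m` the expansion is explicit: its order `j` part carries
`m(m-1)⋯(m-k+j+1)` and the derivatives of `P` at `c`. By Euler's identity a common zero at order `ρ`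
is one at all lower orders, so only `j > ρ` remains and the growth is at most `m^(k-ρ-1)`.

The exponent exists because `l = 0` is admissible by Bombieri's inequality and the powers `⟨z, c⟩^m`
force `l ≤ k`; the two bounds then decide whether `l ≥ k - ρ`. -/

theorem mem_multiIndices {d j : ℕ} {α : Fin d →₀ ℕ} :
    α ∈ multiIndices d j ↔ ∑ i, α i = j := by
  simp [multiIndices, Finset.mem_finsuppAntidiag]

theorem multiIndex_induction {d : ℕ} {p : (Fin d →₀ ℕ) → Prop} (h0 : p 0)
    (h1 : ∀ α i, p α → p (α + Finsupp.single i 1)) (α : Fin d →₀ ℕ) : p α := by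
  induction α using Finsupp.induction with
  | zero => exact h0
  | single_add i n f _ hn ih =>
    clear hn
    rw [add_comm]
    induction n with
    | zero => simpa using ih
    | succ n ihn =>
      rw [Finsupp.single_add, ← add_assoc]
      exact h1 _ _ ihn

theorem exists_eq_add_single {d : ℕ} {α : Fin d →₀ ℕ} {i : Fin d} (h : α i ≠ 0) :
    α - Finsupp.single i 1 + Finsupp.single i 1 = α := by
  apply tsub_add_cancel_of_le
  rw [Finsupp.single_le_iff]
  omega

theorem multiFactorial_add_single {d : ℕ} (α : Fin d →₀ ℕ) (i : Fin d) :
    multiFactorial (α + Finsupp.single i 1) = (α i + 1) * multiFactorial α := by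
  unfold multiFactorial
  rw [← Finset.mul_prod_erase _ _ (Finset.mem_univ i),
    ← Finset.mul_prod_erase _ (fun j => (α j)!) (Finset.mem_univ i), ← mul_assoc]
  congr 1
  · simp [Nat.factorial_succ]
  · refine Finset.prod_congr rfl fun j hj => ?_
    rw [Finsupp.add_apply, Finsupp.single_eq_of_ne (Finset.ne_of_mem_erase hj), add_zero]

theorem multiFactorial_pos {d : ℕ} (α : Fin d →₀ ℕ) : 0 < multiFactorial α :=
  Finset.prod_pos fun _ _ => Nat.factorial_pos _

theorem sum_add_single {d : ℕ} (α : Fin d →₀ ℕ) (i : Fin d) :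
    ∑ l, (α + Finsupp.single i 1 : Fin d →₀ ℕ) l = ∑ l, α l + 1 := by
  simp [Finset.sum_add_distrib, Finsupp.single_apply]

theorem multiIndices_zero (d : ℕ) : multiIndices d 0 = {0} := by
  ext α
  rw [mem_multiIndices, Finset.mem_singleton]
  constructor
  · intro h
    ext i
    simpa using (Finset.sum_eq_zero_iff.1 h) i (Finset.mem_univ i)
  · rintro rfl
    simp

/-- Shifting the summation index by one unit in a sum weighted by `1 / α!`. -/
theorem sum_shift_multiIndices {𝕜 M : Type*} [Field 𝕜] [CharZero 𝕜] [AddCommGroup M] [Module 𝕜 M]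
    {d : ℕ} (j : ℕ) (F : (Fin d →₀ ℕ) → M) :
    ∑ i, ∑ β ∈ multiIndices d j, ((multiFactorial β : 𝕜))⁻¹ • F (β + Finsupp.single i 1) =
      ((j : 𝕜) + 1) • ∑ α ∈ multiIndices d (j + 1), ((multiFactorial α : 𝕜))⁻¹ • F α := by
  have key : ∀ i : Fin d,
      ∑ β ∈ multiIndices d j, ((multiFactorial β : 𝕜))⁻¹ • F (β + Finsupp.single i 1) =
        ∑ α ∈ multiIndices d (j + 1), ((α i : 𝕜) * ((multiFactorial α : 𝕜))⁻¹) • F α := by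
    intro i
    -- The weight `α i` kills the indices outside the image of `β ↦ β + e_i`, and on the image `1 /
    -- β! = α_i / α!`.
    rw [← Finset.sum_filter_of_ne (p := fun α => α i ≠ 0)
      (s := multiIndices d (j + 1))]
    · refine Finset.sum_nbij' (fun β => β + Finsupp.single i 1)
        (fun α => α - Finsupp.single i 1) ?_ ?_ ?_ ?_ ?_
      · intro β hβ
        rw [mem_multiIndices] at hβ
        rw [Finset.mem_filter, mem_multiIndices, sum_add_single, hβ]
        exact ⟨rfl, by simp⟩
      · intro α hα
        rw [Finset.mem_filter, mem_multiIndices] at hα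
        have := sum_add_single (α - Finsupp.single i 1) i
        rw [exists_eq_add_single hα.2] at this
        rw [mem_multiIndices]
        omega
      · intro β _
        simp
      · intro α hα
        exact exists_eq_add_single (Finset.mem_filter.1 hα).2
      · intro β _
        rw [multiFactorial_add_single]
        congr 1
        have h1 : ((multiFactorial β : ℕ) : 𝕜) ≠ 0 :=
          Nat.cast_ne_zero.2 (multiFactorial_pos β).ne'
        have h2 : ((β i : 𝕜) + 1) ≠ 0 := by exact_mod_cast Nat.succ_ne_zero (β i)
        simp
        field_simp
    · intro α _ h h'
      simp [h'] at h
  -- Summed over `i`, the weights `α i` give `|α| = j + 1`.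
  rw [Finset.sum_congr rfl fun i _ => key i, Finset.sum_comm, Finset.smul_sum]
  refine Finset.sum_congr rfl fun α hα => ?_
  rw [mem_multiIndices] at hα
  rw [← Finset.sum_smul, ← Finset.sum_mul, smul_smul]
  congr 2
  exact_mod_cast hα

/-! ### Iterated partial derivatives -/

theorem pderiv_comm {σ R : Type*} [CommSemiring R] (i j : σ) (p : MvPolynomial σ R) :
    pderiv i (pderiv j p) = pderiv j (pderiv i p) := by
  classical
  rcases eq_or_ne i j with rfl | h
  · rfl
  · ext m
    simp only [coeff_pderiv, Finsupp.add_apply, Finsupp.single_eq_of_ne h,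
      Finsupp.single_eq_of_ne h.symm, add_zero]
    rw [add_right_comm]
    ring

section PartialDeriv

variable {d : ℕ}

theorem partialDeriv_zero_left (P : MvPolynomial (Fin d) ℂ) : partialDeriv 0 P = P := by
  unfold partialDeriv
  induction List.finRange d with
  | nil => rfl
  | cons a l ih => simp

/-- The definition folds over a list of variables. In a list without repetition `i` occurs at most
once, and the extra derivative there commutes outwards past the others. -/
theorem partialDeriv_add_single (α : Fin d →₀ ℕ) (i : Fin d) (P : MvPolynomial (Fin d) ℂ) :
    partialDeriv (α + Finsupp.single i 1) P = pderiv i (partialDeriv α P) := by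
  have key : ∀ l : List (Fin d), l.Nodup →
      l.foldr (fun j Q => (⇑(pderiv j))^[(α + Finsupp.single i 1 : Fin d →₀ ℕ) j] Q) P =
        if i ∈ l then pderiv i (l.foldr (fun j Q => (⇑(pderiv j))^[α j] Q) P)
        else l.foldr (fun j Q => (⇑(pderiv j))^[α j] Q) P := by
    intro l
    induction l with
    | nil => simp
    | cons a l ih =>
      intro hl
      rw [List.nodup_cons] at hl
      rw [List.foldr_cons, List.foldr_cons, ih hl.2]
      rcases eq_or_ne i a with rfl | h
      · simp [hl.1, Function.iterate_succ_apply']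
      · have : (α + Finsupp.single i 1 : Fin d →₀ ℕ) a = α a := by
          simp [Finsupp.single_eq_of_ne h.symm]
        rw [this]
        by_cases hi : i ∈ l
        · simp only [hi, if_true, List.mem_cons, or_true]
          have hc : Function.Commute (⇑(pderiv a) : MvPolynomial (Fin d) ℂ → _) (pderiv i) :=
            fun p => pderiv_comm _ _ _
          exact (hc.iterate_left (α a)) _
        · simp [hi, h]
  have := key (List.finRange d) (List.nodup_finRange d)
  simpa [partialDeriv] using this

theorem partialDeriv_add_single' (α : Fin d →₀ ℕ) (i : Fin d) (P : MvPolynomial (Fin d) ℂ) :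
    partialDeriv (α + Finsupp.single i 1) P = partialDeriv α (pderiv i P) := by
  rw [partialDeriv_add_single]
  induction α using multiIndex_induction with
  | h0 => simp only [partialDeriv_zero_left]
  | h1 α j ih => rw [partialDeriv_add_single, partialDeriv_add_single, pderiv_comm, ih]

theorem partialDeriv_pderiv (α : Fin d →₀ ℕ) (i : Fin d) (P : MvPolynomial (Fin d) ℂ) :
    partialDeriv α (pderiv i P) = pderiv i (partialDeriv α P) := by
  rw [← partialDeriv_add_single', partialDeriv_add_single]

/-- `∂^α` as a linear map. -/
noncomputable def partialDerivₗ (α : Fin d →₀ ℕ) :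
    MvPolynomial (Fin d) ℂ →ₗ[ℂ] MvPolynomial (Fin d) ℂ where
  toFun := partialDeriv α
  map_add' P Q := by
    induction α using multiIndex_induction with
    | h0 => simp only [partialDeriv_zero_left]
    | h1 α i ih => simp only [partialDeriv_add_single, ih, map_add]
  map_smul' c P := by
    induction α using multiIndex_induction with
    | h0 => simp only [partialDeriv_zero_left, RingHom.id_apply]
    | h1 α i ih =>
      simp only [partialDeriv_add_single, ih, RingHom.id_apply, Derivation.map_smul]

theorem partialDeriv_conjPoly (α : Fin d →₀ ℕ) (P : MvPolynomial (Fin d) ℂ) :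
    partialDeriv α (conjPoly P) = conjPoly (partialDeriv α P) := by
  induction α using multiIndex_induction with
  | h0 => simp only [partialDeriv_zero_left]
  | h1 α i ih => rw [partialDeriv_add_single, partialDeriv_add_single, ih, conjPoly, pderiv_map,
      conjPoly]

theorem isHomogeneous_partialDeriv {P : MvPolynomial (Fin d) ℂ} {k : ℕ} (hP : P.IsHomogeneous k)
    (α : Fin d →₀ ℕ) : (partialDeriv α P).IsHomogeneous (k - ∑ i, α i) := by
  induction α using multiIndex_induction with
  | h0 => simpa [partialDeriv_zero_left] using hP
  | h1 α i ih =>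
    rw [partialDeriv_add_single, sum_add_single, ← Nat.sub_sub]
    exact ih.pderiv

theorem isHomogeneous_conjPoly {P : MvPolynomial (Fin d) ℂ} {k : ℕ} (hP : P.IsHomogeneous k) :
    (conjPoly P).IsHomogeneous k := hP.map _

theorem eval_conjPoly (c : EuclideanSpace ℂ (Fin d)) (P : MvPolynomial (Fin d) ℂ) :
    evalAt (conjPoint c) (conjPoly P) = conj (evalAt c P) := by
  simp only [evalAt, conjPoly, conjPoint, eval_map]
  rw [← eval₂_id, eval₂_comp_left (starRingEnd ℂ), RingHom.comp_id]
  rfl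

/-! ### Constant coefficient differential operators -/

/-- The differential operator `P(D)`. -/
noncomputable def diffOp :
    MvPolynomial (Fin d) ℂ →ₗ[ℂ] MvPolynomial (Fin d) ℂ →ₗ[ℂ] MvPolynomial (Fin d) ℂ :=
  (basisMonomials (Fin d) ℂ).constr ℂ partialDerivₗ

theorem diffOp_monomial (α : Fin d →₀ ℕ) (c : ℂ) (f : MvPolynomial (Fin d) ℂ) :
    diffOp (monomial α c) f = c • partialDeriv α f := by
  have : monomial α c = c • basisMonomials (Fin d) ℂ α := by simp [smul_monomial]
  rw [this, map_smul, diffOp, Module.Basis.constr_basis]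
  rfl

theorem diffOp_C (c : ℂ) (f : MvPolynomial (Fin d) ℂ) : diffOp (C c) f = c • f := by
  rw [C_apply, diffOp_monomial, partialDeriv_zero_left]

theorem diffOp_mul_X' (P f : MvPolynomial (Fin d) ℂ) (i : Fin d) :
    diffOp (P * X i) f = diffOp P (pderiv i f) := by
  induction P using MvPolynomial.induction_on' with
  | monomial α c =>
    rw [X, monomial_mul, mul_one, diffOp_monomial, diffOp_monomial, partialDeriv_add_single']
  | add p q hp hq => simp only [add_mul, map_add, LinearMap.add_apply, hp, hq]

/-- Euler's identity `∑ X_i ∂_i P = k P`, read as an identity of differential operators. It lets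
inductions on the degree of `P` replace computations with coefficients. -/
theorem euler_diffOp {P : MvPolynomial (Fin d) ℂ} {k : ℕ} (hP : P.IsHomogeneous k)
    (f : MvPolynomial (Fin d) ℂ) :
    ∑ i, diffOp (pderiv i P) (pderiv i f) = (k : ℂ) • diffOp P f := by
  have h := congrArg (fun Q => diffOp Q f) hP.sum_X_mul_pderiv
  simp only [map_sum, LinearMap.sum_apply, map_nsmul, LinearMap.smul_apply] at h
  rw [Nat.cast_smul_eq_nsmul, ← h]
  refine Finset.sum_congr rfl fun i _ => ?_
  rw [mul_comm, diffOp_mul_X']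

/-- The Leibniz rule for the operator `P(D)` acting on a product. -/
theorem diffOp_mul {k : ℕ} {P : MvPolynomial (Fin d) ℂ} (hP : P.IsHomogeneous k)
    (Q f : MvPolynomial (Fin d) ℂ) :
    diffOp P (Q * f) = ∑ j ∈ Finset.range (k + 1), ∑ α ∈ multiIndices d j,
      ((multiFactorial α : ℂ))⁻¹ • (partialDeriv α Q * diffOp (partialDeriv α P) f) := by
  induction k generalizing P Q f with
  | zero =>
    rw [← totalDegree_zero_iff_isHomogeneous, totalDegree_eq_zero_iff_eq_C] at hP
    rw [hP]
    simp [multiIndices_zero, partialDeriv_zero_left, diffOp_C, multiFactorial]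
  | succ k ih =>
    set S : ℕ → MvPolynomial (Fin d) ℂ := fun j => ∑ α ∈ multiIndices d j,
      ((multiFactorial α : ℂ))⁻¹ • (partialDeriv α Q * diffOp (partialDeriv α P) f) with hS
    have h1 : ∀ j, ∑ i, ∑ α ∈ multiIndices d j, ((multiFactorial α : ℂ))⁻¹ •
        (partialDeriv α (pderiv i Q) * diffOp (partialDeriv α (pderiv i P)) f) =
        ((j : ℂ) + 1) • S (j + 1) := by
      intro j
      rw [hS, ← sum_shift_multiIndices]
      simp only [partialDeriv_add_single']
    have h2 : ∀ j ∈ Finset.range (k + 1), ∑ i, ∑ α ∈ multiIndices d j, ((multiFactorial α : ℂ))⁻¹ •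
        (partialDeriv α Q * diffOp (partialDeriv α (pderiv i P)) (pderiv i f)) =
        ((k : ℂ) + 1 - j) • S j := by
      intro j hj
      rw [Finset.mem_range] at hj
      rw [hS, Finset.sum_comm, Finset.smul_sum]
      refine Finset.sum_congr rfl fun α hα => ?_
      rw [mem_multiIndices] at hα
      have := isHomogeneous_partialDeriv hP α
      rw [hα] at this
      simp only [partialDeriv_pderiv]
      rw [← Finset.smul_sum, ← Finset.mul_sum, euler_diffOp this, mul_smul_comm, smul_comm]
      congr 2
      push_cast [Nat.cast_sub (show j ≤ k + 1 by omega)]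
      ring
    have hk : ((k : ℂ) + 1) ≠ 0 := by exact_mod_cast Nat.succ_ne_zero k
    -- By Euler, `(k+1) P(D)(Q f)` is the sum of `(∂_i P)(D)` applied to `∂_i Q · f + Q · ∂_i f`. By
    -- induction the two halves contribute `j S_j` and `(k+1-j) S_j`, with total weight `k+1`.
    have h3 : ((k : ℂ) + 1) • diffOp P (Q * f) =
        ((k : ℂ) + 1) • ∑ j ∈ Finset.range (k + 1 + 1), S j := by
      have e := euler_diffOp hP (Q * f)
      push_cast at e
      rw [← e]
      simp only [pderiv_mul, map_add]
      rw [Finset.sum_congr rfl fun i _ => congrArg₂ (· + ·)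
        (ih hP.pderiv (pderiv i Q) f) (ih hP.pderiv Q (pderiv i f))]
      rw [Finset.sum_add_distrib, Finset.sum_comm,
        Finset.sum_comm (s := Finset.univ) (t := Finset.range (k + 1)),
        Finset.sum_congr rfl fun j _ => h1 j, Finset.sum_congr rfl h2, Finset.smul_sum]
      -- Both ranges extend to `0 ≤ j ≤ k+1`, since the added terms have coefficient zero.
      have e1 : ∑ j ∈ Finset.range (k + 1), ((j : ℂ) + 1) • S (j + 1) =
          ∑ j ∈ Finset.range (k + 1 + 1), (j : ℂ) • S j := by
        rw [Finset.sum_range_succ' _ (k + 1)]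
        simp
      have e2 : ∑ j ∈ Finset.range (k + 1), ((k : ℂ) + 1 - j) • S j =
          ∑ j ∈ Finset.range (k + 1 + 1), ((k : ℂ) + 1 - j) • S j := by
        rw [Finset.sum_range_succ _ (k + 1)]
        simp
      rw [e1, e2, ← Finset.sum_add_distrib]
      refine Finset.sum_congr rfl fun j _ => ?_
      rw [← add_smul]
      congr 1
      ring
    exact smul_right_injective _ hk h3

end PartialDeriv

/-! ### The apolar inner product -/

section Apolar

variable {d : ℕ}

theorem apolarInner_eq_sum {P : MvPolynomial (Fin d) ℂ} (Q : MvPolynomial (Fin d) ℂ)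
    {s : Finset (Fin d →₀ ℕ)} (hs : P.support ⊆ s) :
    apolarInner P Q = ∑ α ∈ s, (multiFactorial α : ℂ) * coeff α P * conj (coeff α Q) := by
  refine Finset.sum_subset hs fun α _ h => ?_
  rw [notMem_support_iff.1 h]
  simp

theorem apolarInner_add_left (P P' Q : MvPolynomial (Fin d) ℂ) :
    apolarInner (P + P') Q = apolarInner P Q + apolarInner P' Q := by
  classical
  rw [apolarInner_eq_sum Q (support_add (p := P) (q := P')),
    apolarInner_eq_sum Q (Finset.subset_union_left (s₁ := P.support) (s₂ := P'.support)),
    apolarInner_eq_sum Q (Finset.subset_union_right (s₁ := P.support) (s₂ := P'.support)),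
    ← Finset.sum_add_distrib]
  refine Finset.sum_congr rfl fun α _ => ?_
  rw [coeff_add]
  ring

theorem apolarInner_smul_left (c : ℂ) (P Q : MvPolynomial (Fin d) ℂ) :
    apolarInner (c • P) Q = c * apolarInner P Q := by
  rw [apolarInner_eq_sum Q (support_smul (f := P) (a := c)), apolarInner, Finset.mul_sum]
  refine Finset.sum_congr rfl fun α _ => ?_
  rw [coeff_smul, smul_eq_mul]
  ring

theorem apolarInner_conj_symm (P Q : MvPolynomial (Fin d) ℂ) :
    conj (apolarInner P Q) = apolarInner Q P := by
  classical
  rw [apolarInner_eq_sum Q (Finset.subset_union_left (s₁ := P.support) (s₂ := Q.support)),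
    apolarInner_eq_sum P (Finset.subset_union_right (s₁ := P.support) (s₂ := Q.support)), map_sum]
  refine Finset.sum_congr rfl fun α _ => ?_
  simp
  ring

theorem apolarInner_add_right (P Q Q' : MvPolynomial (Fin d) ℂ) :
    apolarInner P (Q + Q') = apolarInner P Q + apolarInner P Q' := by
  rw [← apolarInner_conj_symm, apolarInner_add_left, map_add, apolarInner_conj_symm,
    apolarInner_conj_symm]

theorem apolarInner_smul_right (c : ℂ) (P Q : MvPolynomial (Fin d) ℂ) :
    apolarInner P (c • Q) = conj c * apolarInner P Q := by
  rw [← apolarInner_conj_symm, apolarInner_smul_left, map_mul, apolarInner_conj_symm]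

theorem apolarInner_sum_left {ι : Type*} (s : Finset ι) (F : ι → MvPolynomial (Fin d) ℂ)
    (Q : MvPolynomial (Fin d) ℂ) :
    apolarInner (∑ i ∈ s, F i) Q = ∑ i ∈ s, apolarInner (F i) Q := by
  classical
  induction s using Finset.induction_on with
  | empty => simp [apolarInner]
  | insert a s ha ih => rw [Finset.sum_insert ha, Finset.sum_insert ha, apolarInner_add_left, ih]

theorem apolarInner_sum_right {ι : Type*} (s : Finset ι) (F : ι → MvPolynomial (Fin d) ℂ)
    (P : MvPolynomial (Fin d) ℂ) :
    apolarInner P (∑ i ∈ s, F i) = ∑ i ∈ s, apolarInner P (F i) := by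
  rw [← apolarInner_conj_symm, apolarInner_sum_left, map_sum]
  simp only [apolarInner_conj_symm]

/-- Multiplication by a variable is adjoint to differentiation. -/
theorem apolarInner_X_mul (i : Fin d) (P Q : MvPolynomial (Fin d) ℂ) :
    apolarInner (P * X i) Q = apolarInner P (pderiv i Q) := by
  rw [apolarInner, apolarInner, support_mul_X, Finset.sum_map]
  refine Finset.sum_congr rfl fun α _ => ?_
  rw [addRightEmbedding_apply, coeff_mul_X, coeff_pderiv, multiFactorial_add_single]
  simp
  ring

theorem conjPoly_add (P Q : MvPolynomial (Fin d) ℂ) :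
    conjPoly (P + Q) = conjPoly P + conjPoly Q := map_add _ _ _

theorem conjPoly_mul_X (P : MvPolynomial (Fin d) ℂ) (i : Fin d) :
    conjPoly (P * X i) = conjPoly P * X i := by
  rw [conjPoly, map_mul, map_X, conjPoly]

/-- Multiplication by `P` is adjoint to `P^*(D)`. -/
theorem apolarInner_mul_left (P f g : MvPolynomial (Fin d) ℂ) :
    apolarInner (P * f) g = apolarInner f (diffOp (conjPoly P) g) := by
  induction P using MvPolynomial.induction_on generalizing f g with
  | C a =>
    rw [conjPoly, map_C, diffOp_C, apolarInner_smul_right, ← smul_eq_C_mul,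
      apolarInner_smul_left]
    simp
  | add p q hp hq =>
    rw [add_mul, apolarInner_add_left, hp, hq, conjPoly_add, map_add, LinearMap.add_apply,
      apolarInner_add_right]
  | mul_X p i hp =>
    rw [mul_right_comm, apolarInner_X_mul, hp, conjPoly_mul_X, diffOp_mul_X']

theorem apolarInner_mul_right (P f g : MvPolynomial (Fin d) ℂ) :
    apolarInner f (P * g) = apolarInner (diffOp (conjPoly P) f) g := by
  rw [← apolarInner_conj_symm, apolarInner_mul_left, apolarInner_conj_symm]

theorem apolarInner_self (f : MvPolynomial (Fin d) ℂ) :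
    apolarInner f f = ((∑ α ∈ f.support, (multiFactorial α : ℝ) * ‖coeff α f‖ ^ 2 : ℝ) : ℂ) := by
  rw [apolarInner]
  push_cast
  refine Finset.sum_congr rfl fun α _ => ?_
  rw [mul_assoc, Complex.mul_conj']

theorem apolarNorm_nonneg (f : MvPolynomial (Fin d) ℂ) : 0 ≤ apolarNorm f := Real.sqrt_nonneg _

theorem apolarNorm_sq (f : MvPolynomial (Fin d) ℂ) :
    apolarNorm f ^ 2 = (apolarInner f f).re := by
  rw [apolarNorm, Real.sq_sqrt]
  rw [apolarInner_self, Complex.ofReal_re]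
  positivity

theorem apolarNorm_sq_ofReal (f : MvPolynomial (Fin d) ℂ) :
    ((apolarNorm f ^ 2 : ℝ) : ℂ) = apolarInner f f := by
  rw [apolarNorm_sq, apolarInner_self, Complex.ofReal_re]

theorem apolarNorm_smul_sq (c : ℂ) (f : MvPolynomial (Fin d) ℂ) :
    apolarNorm (c • f) ^ 2 = ‖c‖ ^ 2 * apolarNorm f ^ 2 := by
  apply Complex.ofReal_injective
  rw [apolarNorm_sq_ofReal, apolarInner_smul_left, apolarInner_smul_right, ← mul_assoc,
    Complex.mul_conj', ← apolarNorm_sq_ofReal]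
  push_cast
  ring

theorem apolarNorm_pos {f : MvPolynomial (Fin d) ℂ} (hf : f ≠ 0) : 0 < apolarNorm f := by
  rw [apolarNorm, Real.sqrt_pos, apolarInner_self, Complex.ofReal_re]
  refine Finset.sum_pos (fun α hα => ?_) (support_nonempty.2 hf)
  have := multiFactorial_pos α
  have := norm_pos_iff.2 (mem_support_iff.1 hα)
  positivity

/-- The expansion of `‖P f‖²` in the norms of `(∂^α P^*)(D) f`. -/
theorem apolarNorm_mul_sq {k : ℕ} {P : MvPolynomial (Fin d) ℂ} (hP : P.IsHomogeneous k)
    (f : MvPolynomial (Fin d) ℂ) :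
    apolarNorm (P * f) ^ 2 = ∑ j ∈ Finset.range (k + 1), ∑ α ∈ multiIndices d j,
      ((multiFactorial α : ℝ))⁻¹ *
        apolarNorm (diffOp (partialDeriv α (conjPoly P)) f) ^ 2 := by
  apply Complex.ofReal_injective
  rw [apolarNorm_sq_ofReal, apolarInner_mul_left, diffOp_mul (isHomogeneous_conjPoly hP),
    apolarInner_sum_right]
  push_cast
  refine Finset.sum_congr rfl fun j _ => ?_
  rw [apolarInner_sum_right]
  refine Finset.sum_congr rfl fun α _ => ?_
  rw [apolarInner_smul_right, apolarInner_mul_right, ← partialDeriv_conjPoly]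
  norm_cast
  rw [apolarNorm_sq_ofReal]
  simp

end Apolar

/-! ### Consequences of the expansion of `‖P f‖²` -/

section Estimates

variable {d : ℕ}

theorem conjPoly_pderiv (i : Fin d) (P : MvPolynomial (Fin d) ℂ) :
    conjPoly (pderiv i P) = pderiv i (conjPoly P) := by
  rw [conjPoly, conjPoly, pderiv_map]

/-- After the index shift, the left side is the expansion of `‖P f‖²` with its order `j` part
multiplied by `j ≤ k`. -/
theorem sum_apolarNorm_pderiv_mul_sq_le {k : ℕ} {P : MvPolynomial (Fin d) ℂ}
    (hP : P.IsHomogeneous k) (f : MvPolynomial (Fin d) ℂ) :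
    ∑ i, apolarNorm (pderiv i P * f) ^ 2 ≤ k * apolarNorm (P * f) ^ 2 := by
  cases k with
  | zero =>
    rw [← totalDegree_zero_iff_isHomogeneous, totalDegree_eq_zero_iff_eq_C] at hP
    rw [hP]
    simp [apolarNorm, apolarInner]
  | succ k =>
    rw [apolarNorm_mul_sq hP,
      Finset.sum_congr rfl fun i _ => apolarNorm_mul_sq (hP.pderiv (i := i)) f, Finset.sum_comm,
      Nat.add_sub_cancel, Finset.sum_range_succ' _ (k + 1)]
    have : ∀ j, ∑ i, ∑ α ∈ multiIndices d j, ((multiFactorial α : ℝ))⁻¹ *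
        apolarNorm (diffOp (partialDeriv α (conjPoly (pderiv i P))) f) ^ 2 =
        ((j : ℝ) + 1) * ∑ α ∈ multiIndices d (j + 1), ((multiFactorial α : ℝ))⁻¹ *
        apolarNorm (diffOp (partialDeriv α (conjPoly P)) f) ^ 2 := by
      intro j
      have := sum_shift_multiIndices (𝕜 := ℝ) j
        fun α => apolarNorm (diffOp (partialDeriv α (conjPoly P)) f) ^ 2
      simp only [smul_eq_mul, partialDeriv_add_single'] at this
      rw [← this]
      simp only [conjPoly_pderiv]
    rw [Finset.sum_congr rfl fun j _ => this j, mul_add, Finset.mul_sum]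
    refine le_add_of_le_of_nonneg (Finset.sum_le_sum fun j hj => ?_) (by positivity)
    rw [Finset.mem_range] at hj
    refine mul_le_mul_of_nonneg_right ?_ (by positivity)
    exact_mod_cast Nat.succ_le_of_lt hj

theorem apolarNorm_partialDeriv_mul_sq_le {k : ℕ} {P : MvPolynomial (Fin d) ℂ}
    (hP : P.IsHomogeneous k) (f : MvPolynomial (Fin d) ℂ) (α : Fin d →₀ ℕ) :
    apolarNorm (partialDeriv α P * f) ^ 2 ≤ (k : ℝ) ^ (∑ i, α i) * apolarNorm (P * f) ^ 2 := by
  induction α using multiIndex_induction with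
  | h0 => simp [partialDeriv_zero_left]
  | h1 α i ih =>
    rw [partialDeriv_add_single, sum_add_single, pow_succ' (k : ℝ), mul_assoc]
    have h := sum_apolarNorm_pderiv_mul_sq_le (isHomogeneous_partialDeriv hP α) f
    have h1 := Finset.single_le_sum (f := fun i => apolarNorm (pderiv i (partialDeriv α P) * f) ^ 2)
      (fun _ _ => sq_nonneg _) (Finset.mem_univ i)
    refine (h1.trans h).trans (mul_le_mul ?_ ih (by positivity) (by positivity))
    exact_mod_cast Nat.sub_le _ _

theorem partialDeriv_eq_C {P : MvPolynomial (Fin d) ℂ} {α : Fin d →₀ ℕ}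
    (hP : P.IsHomogeneous (∑ i, α i)) :
    partialDeriv α P = C ((multiFactorial α : ℂ) * coeff α P) := by
  induction α using multiIndex_induction generalizing P with
  | h0 =>
    simp only [Finsupp.coe_zero, Pi.zero_apply, Finset.sum_const_zero] at hP
    rw [← totalDegree_zero_iff_isHomogeneous, totalDegree_eq_zero_iff_eq_C] at hP
    rw [partialDeriv_zero_left]
    simpa [multiFactorial] using hP
  | h1 α i ih =>
    rw [sum_add_single] at hP
    rw [partialDeriv_add_single', ih hP.pderiv, coeff_pderiv, multiFactorial_add_single]
    congr 1
    push_cast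
    ring

/-- Bombieri's inequality. -/
theorem apolarNorm_mul_apolarNorm_le {k : ℕ} {P : MvPolynomial (Fin d) ℂ}
    (hP : P.IsHomogeneous k) (f : MvPolynomial (Fin d) ℂ) :
    apolarNorm P * apolarNorm f ≤ apolarNorm (P * f) := by
  refine le_of_sq_le_sq ?_ (apolarNorm_nonneg _)
  -- Only the terms with `|α| = k` are kept: there `∂^α P^*` is the constant `α! conj(p_α)`, and
  -- these terms add up to exactly `‖P‖² ‖f‖²`.
  rw [apolarNorm_mul_sq hP, Finset.sum_range_succ]
  refine le_add_of_nonneg_of_le (by positivity) ?_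
  have hs : P.support ⊆ multiIndices d k := by
    intro α hα
    rw [mem_multiIndices, ← hP (mem_support_iff.1 hα)]
    simp [Finsupp.weight_apply, Finsupp.sum_fintype]
  have h1 : apolarNorm P ^ 2 = ∑ α ∈ multiIndices d k,
      (multiFactorial α : ℝ) * ‖coeff α P‖ ^ 2 := by
    rw [apolarNorm_sq, apolarInner_self, Complex.ofReal_re]
    refine Finset.sum_subset hs fun α _ h => ?_
    rw [notMem_support_iff.1 h]
    simp
  rw [mul_pow, h1, Finset.sum_mul]
  refine (Finset.sum_congr rfl fun α hα => ?_).le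
  rw [mem_multiIndices] at hα
  subst hα
  rw [partialDeriv_eq_C (isHomogeneous_conjPoly hP), diffOp_C, apolarNorm_smul_sq, conjPoly,
    coeff_map]
  have := multiFactorial_pos α
  simp
  field_simp

/-! ### Powers of a linear form -/

/-- The truncated exponent at `m = 0` is harmless, as the coefficient vanishes. -/
theorem pderiv_innerPoly_pow (c : EuclideanSpace ℂ (Fin d)) (i : Fin d) (m : ℕ) :
    pderiv i (innerPoly c ^ m) = ((m : ℂ) * conj (c i)) • innerPoly c ^ (m - 1) := by
  have : pderiv i (innerPoly c) = C (conj (c i)) := by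
    rw [innerPoly, map_sum]
    simp [pderiv_X, Pi.single_apply]
  rw [pderiv_pow, this, smul_eq_C_mul, C_mul]
  simp
  ring

theorem eval_euler {Q : MvPolynomial (Fin d) ℂ} {j : ℕ} (hQ : Q.IsHomogeneous j)
    (c : EuclideanSpace ℂ (Fin d)) :
    ∑ i, c i * evalAt c (pderiv i Q) = j * evalAt c Q := by
  have := congrArg (evalAt c) hQ.sum_X_mul_pderiv
  simpa [evalAt] using this

/-- Each `∂_i` brings down the exponent and a factor `conj(c_i)`. The exponents accumulate to a
falling factorial, and the other factors reassemble through Euler's identity to `Q` at the conjugate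
point. -/
theorem diffOp_innerPoly_pow {j m : ℕ} (hj : j ≤ m) {Q : MvPolynomial (Fin d) ℂ}
    (hQ : Q.IsHomogeneous j) (c : EuclideanSpace ℂ (Fin d)) :
    diffOp Q (innerPoly c ^ m) =
      ((m.descFactorial j : ℂ) * evalAt (conjPoint c) Q) • innerPoly c ^ (m - j) := by
  induction j generalizing m Q with
  | zero =>
    rw [← totalDegree_zero_iff_isHomogeneous, totalDegree_eq_zero_iff_eq_C] at hQ
    rw [hQ]
    simp [diffOp_C, evalAt]
  | succ j ih =>
    obtain ⟨m, rfl⟩ : ∃ n, m = n + 1 := ⟨m - 1, by omega⟩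
    have e := euler_diffOp hQ (innerPoly c ^ (m + 1))
    have hk : (((j + 1 : ℕ) : ℂ)) ≠ 0 := by exact_mod_cast Nat.succ_ne_zero j
    refine smul_right_injective _ hk ?_
    change ((j + 1 : ℕ) : ℂ) • _ = ((j + 1 : ℕ) : ℂ) • _
    rw [← e]
    simp only [pderiv_innerPoly_pow, map_smul, Nat.add_sub_cancel]
    rw [Finset.sum_congr rfl fun i _ => by
      rw [ih (by omega) (hQ.pderiv (i := i)), smul_smul], ← Finset.sum_smul, smul_smul,
      Nat.add_sub_add_right]
    congr 1
    rw [mul_left_comm, ← eval_euler hQ, Finset.mul_sum, Nat.succ_descFactorial_succ]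
    refine Finset.sum_congr rfl fun i _ => ?_
    simp only [conjPoint]
    push_cast
    ring

theorem sum_conj_mul_self {c : EuclideanSpace ℂ (Fin d)} (hc : ‖c‖ = 1) :
    ∑ i, conj (c i) * c i = 1 := by
  have h := EuclideanSpace.norm_sq_eq c
  rw [hc, one_pow] at h
  simp only [Complex.conj_mul']
  exact_mod_cast h.symm

/-- Moving one factor `⟨z, c⟩` to the other side as a derivative produces `(m + 1) |c|² = m + 1`. -/
theorem apolarNorm_innerPoly_pow_sq {c : EuclideanSpace ℂ (Fin d)} (hc : ‖c‖ = 1) (m : ℕ) :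
    apolarNorm (innerPoly c ^ m) ^ 2 = m ! := by
  apply Complex.ofReal_injective
  rw [apolarNorm_sq_ofReal]
  induction m with
  | zero =>
    rw [pow_zero, apolarInner_eq_sum (s := {0}) 1 support_one.subset]
    simp [multiFactorial]
  | succ m ih =>
    have : innerPoly c ^ (m + 1) = ∑ i, conj (c i) • (innerPoly c ^ m * X i) := by
      rw [pow_succ]
      conv_lhs => rw [innerPoly]
      rw [Finset.mul_sum]
      refine Finset.sum_congr rfl fun i _ => ?_
      rw [smul_eq_C_mul]
      simp only [innerPoly]
      ring
    conv_lhs => enter [1]; rw [this]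
    rw [apolarInner_sum_left]
    simp only [apolarInner_smul_left, apolarInner_X_mul, pderiv_innerPoly_pow,
      apolarInner_smul_right, Nat.add_sub_cancel, ih]
    have h := congrArg (· * (((m : ℂ) + 1) * (m ! : ℂ))) (sum_conj_mul_self hc)
    simp only [one_mul, Finset.sum_mul] at h
    rw [Nat.factorial_succ]
    push_cast
    rw [← h]
    refine Finset.sum_congr rfl fun i _ => ?_
    simp
    ring

/-- The exact value of `‖P ⟨z, c⟩^m‖²`. -/
theorem apolarNorm_mul_innerPoly_pow_sq {k m : ℕ} {P : MvPolynomial (Fin d) ℂ}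
    (hP : P.IsHomogeneous k) (hm : k ≤ m) {c : EuclideanSpace ℂ (Fin d)} (hc : ‖c‖ = 1) :
    apolarNorm (P * innerPoly c ^ m) ^ 2 =
      (∑ j ∈ Finset.range (k + 1), (m.descFactorial (k - j) : ℝ) * ∑ α ∈ multiIndices d j,
        ‖evalAt (conjPoint c) (partialDeriv α (conjPoly P))‖ ^ 2 / (multiFactorial α : ℝ)) *
      apolarNorm (innerPoly c ^ m) ^ 2 := by
  rw [apolarNorm_mul_sq hP, Finset.sum_mul]
  refine Finset.sum_congr rfl fun j hj => ?_
  rw [Finset.mul_sum, Finset.sum_mul]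
  refine Finset.sum_congr rfl fun α hα => ?_
  rw [Finset.mem_range] at hj
  rw [mem_multiIndices] at hα
  have hh := isHomogeneous_partialDeriv (isHomogeneous_conjPoly hP) α
  rw [hα] at hh
  rw [diffOp_innerPoly_pow (by omega) hh, apolarNorm_smul_sq, apolarNorm_innerPoly_pow_sq hc,
    apolarNorm_innerPoly_pow_sq hc, ← Nat.factorial_mul_descFactorial (show k - j ≤ m by omega)]
  push_cast
  rw [norm_mul, Complex.norm_natCast]
  ring

/-- Euler's identity at `c` expresses `(k - j) ∂^α P(c)`, `|α| = j`, through derivatives of order `j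
+ 1`; for `j < ρ ≤ k` the factor is nonzero, so vanishing descends. -/
theorem evalAt_eq_zero_of_partialDeriv {P : MvPolynomial (Fin d) ℂ} {k ρ : ℕ}
    (hP : P.IsHomogeneous k) (hρ : ρ ≤ k) {c : EuclideanSpace ℂ (Fin d)}
    (h : IsCommonZero P ρ c) {j : ℕ} (hj : j ≤ ρ) : IsCommonZero P j c := by
  induction hj using Nat.decreasingInduction with
  | self => exact h
  | of_succ j hj ih =>
    intro α hα
    have hα' := mem_multiIndices.1 hα
    have hh := isHomogeneous_partialDeriv hP α
    rw [hα'] at hh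
    have e := eval_euler hh c
    rw [Finset.sum_eq_zero] at e
    · have : ((k - j : ℕ) : ℂ) ≠ 0 := by
        rw [Nat.cast_ne_zero]
        omega
      exact (mul_eq_zero.1 e.symm).resolve_left this
    · intro i _
      rw [← partialDeriv_add_single, ih _ (by rw [mem_multiIndices, sum_add_single, hα']), mul_zero]

/-- An upper bound for `‖P ⟨z, c⟩^m‖` when `P` vanishes to order `s` at `c`. -/
theorem apolarNorm_mul_innerPoly_pow_le {k m s : ℕ} {P : MvPolynomial (Fin d) ℂ}
    (hP : P.IsHomogeneous k) (hm : k ≤ m) (hm0 : 1 ≤ m) (hs : s ≤ k)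
    {c : EuclideanSpace ℂ (Fin d)} (hc : ‖c‖ = 1) (h : ∀ j < s, IsCommonZero P j c) :
    apolarNorm (P * innerPoly c ^ m) ≤
      √(∑ j ∈ Finset.Ico s (k + 1), ∑ α ∈ multiIndices d j,
        ‖evalAt (conjPoint c) (partialDeriv α (conjPoly P))‖ ^ 2 / (multiFactorial α : ℝ)) *
        (m : ℝ) ^ (((k : ℝ) - s) / 2) * apolarNorm (innerPoly c ^ m) := by
  refine le_of_sq_le_sq ?_ (mul_nonneg (by positivity) (apolarNorm_nonneg _))
  rw [apolarNorm_mul_innerPoly_pow_sq hP hm hc, mul_pow, mul_pow, Real.sq_sqrt (by positivity)]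
  refine mul_le_mul_of_nonneg_right ?_ (sq_nonneg _)
  have e : ((m : ℝ) ^ (((k : ℝ) - s) / 2)) ^ 2 = (m : ℝ) ^ (k - s) := by
    rw [← Real.rpow_natCast, ← Real.rpow_mul (by positivity), ← Real.rpow_natCast, Nat.cast_sub hs]
    congr 1
    push_cast
    ring
  rw [e, ← Finset.sum_range_add_sum_Ico _ (show s ≤ k + 1 by omega), Finset.sum_eq_zero, zero_add,
    mul_comm, Finset.mul_sum]
  · refine Finset.sum_le_sum fun j hj => ?_
    rw [Finset.mem_Ico] at hj
    refine mul_le_mul_of_nonneg_right ?_ (by positivity)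
    -- Among the surviving orders `j ≥ s`, the power of `m` is largest at `j = s`.
    calc (m.descFactorial (k - j) : ℝ) ≤ (m : ℝ) ^ (k - j) := by
          exact_mod_cast Nat.descFactorial_le_pow _ _
      _ ≤ (m : ℝ) ^ (k - s) := pow_le_pow_right₀ (by exact_mod_cast hm0) (by omega)
  · intro j hj
    rw [Finset.sum_eq_zero, mul_zero]
    intro α hα
    rw [partialDeriv_conjPoly, eval_conjPoly, h j (Finset.mem_range.1 hj) α hα]
    simp

end Estimates

/-! ### The apolar norm as a Gaussian integral in polar coordinates -/

open MeasureTheory in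
theorem integrable_radial (n : ℕ) :
    Integrable (fun t : ℝ => Real.exp (-t) * √t ^ n) (volume.restrict (Set.Ioi 0)) := by
  have h := Real.GammaIntegral_convergent (s := (n : ℝ) / 2 + 1) (by positivity)
  refine (integrableOn_congr_fun ?_ measurableSet_Ioi).1 h
  intro t ht
  have ht' : (0 : ℝ) ≤ t := le_of_lt ht
  simp only [add_sub_cancel_right]
  rw [Real.sqrt_eq_rpow, ← Real.rpow_natCast, ← Real.rpow_mul ht']
  congr 2
  ring

open MeasureTheory in
-- Even exponents suffice: the angular integral annihilates the moments with `a ≠ b`.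
theorem integral_radial (a : ℕ) :
    ∫ t in Set.Ioi (0 : ℝ), Real.exp (-t) * √t ^ (a + a) = a ! := by
  rw [← Real.Gamma_nat_eq_factorial, Real.Gamma_eq_integral (by positivity)]
  refine setIntegral_congr_fun measurableSet_Ioi fun t ht => ?_
  have ht' : (0 : ℝ) ≤ t := le_of_lt ht
  simp only [add_sub_cancel_right]
  rw [← two_mul, pow_mul, Real.sq_sqrt ht', Real.rpow_natCast]

open MeasureTheory in
theorem integral_angular (a b : ℕ) :
    ∫ θ in Set.Ioc (0 : ℝ) (2 * Real.pi),
      Complex.exp (((a : ℂ) - b) * Complex.I * θ) / (2 * Real.pi) = if a = b then 1 else 0 := by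
  rw [integral_div, ← intervalIntegral.integral_of_le Real.two_pi_pos.le]
  have hpi : (2 * (Real.pi : ℂ)) ≠ 0 := by exact_mod_cast Real.two_pi_pos.ne'
  split_ifs with h
  · subst h
    simp only [sub_self, zero_mul, Complex.exp_zero]
    rw [intervalIntegral.integral_const]
    simp [hpi]
  · have hne : ((a : ℂ) - b) * Complex.I ≠ 0 :=
      mul_ne_zero (sub_ne_zero.2 (by exact_mod_cast h)) Complex.I_ne_zero
    rw [integral_exp_mul_complex hne]
    have : Complex.exp (((a : ℂ) - b) * Complex.I * ((2 * Real.pi : ℝ) : ℂ)) = 1 := by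
      rw [Complex.exp_eq_one_iff]
      exact ⟨(a : ℤ) - b, by push_cast; ring⟩
    rw [this]
    simp

/-- The point of the plane with squared modulus `x.1` and argument `x.2`. -/
noncomputable def polarPoint (x : ℝ × ℝ) : ℂ := √x.1 * Complex.exp (x.2 * Complex.I)

/-- The Gaussian density in the coordinates `x.1 = |z|²`, `x.2 = arg z`. -/
noncomputable def polarWeight (x : ℝ × ℝ) : ℝ := Real.exp (-x.1) / (2 * Real.pi)

/-- Lebesgue measure on the half strip of polar coordinates. -/
noncomputable def polarMeasure : MeasureTheory.Measure (ℝ × ℝ) :=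
  (MeasureTheory.volume.restrict (Set.Ioi 0)).prod
    (MeasureTheory.volume.restrict (Set.Ioc 0 (2 * Real.pi)))

instance : MeasureTheory.SigmaFinite polarMeasure := by
  unfold polarMeasure
  infer_instance

/-- Separates radius and angle, so that the planar moments factor by Fubini. -/
theorem polarWeight_mul_eq (a b : ℕ) (x : ℝ × ℝ) :
    (polarWeight x : ℂ) * (polarPoint x ^ a * conj (polarPoint x) ^ b) =
      ((Real.exp (-x.1) * √x.1 ^ (a + b) : ℝ) : ℂ) *
        (Complex.exp (((a : ℂ) - b) * Complex.I * x.2) / (2 * Real.pi)) := by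
  have h1 : Complex.exp (((a : ℂ) - b) * Complex.I * x.2) =
      Complex.exp (x.2 * Complex.I) ^ a * Complex.exp (-(x.2 * Complex.I)) ^ b := by
    rw [← Complex.exp_nat_mul, ← Complex.exp_nat_mul, ← Complex.exp_add]
    congr 1
    ring
  rw [h1, polarWeight, polarPoint, map_mul, ← Complex.exp_conj, map_mul, Complex.conj_I,
    Complex.conj_ofReal, Complex.conj_ofReal, mul_neg, mul_pow, mul_pow, pow_add]
  push_cast
  ring

open MeasureTheory in
theorem integrable_polar_moment (a b : ℕ) :
    Integrable (fun x => (polarWeight x : ℂ) * (polarPoint x ^ a * conj (polarPoint x) ^ b))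
      polarMeasure := by
  simp only [polarWeight_mul_eq]
  refine Integrable.mul_prod (f := fun t : ℝ => ((Real.exp (-t) * √t ^ (a + b) : ℝ) : ℂ))
    (g := fun θ : ℝ => Complex.exp (((a : ℂ) - b) * Complex.I * θ) / (2 * Real.pi))
    (integrable_radial _).ofReal ?_
  exact Continuous.integrableOn_Ioc (by fun_prop)

open MeasureTheory in
theorem integral_polar_moment (a b : ℕ) :
    ∫ x, (polarWeight x : ℂ) * (polarPoint x ^ a * conj (polarPoint x) ^ b) ∂polarMeasure =
      if a = b then (a ! : ℂ) else 0 := by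
  simp only [polarWeight_mul_eq]
  rw [polarMeasure, integral_prod_mul
    (fun t : ℝ => ((Real.exp (-t) * √t ^ (a + b) : ℝ) : ℂ))
    (fun θ : ℝ => Complex.exp (((a : ℂ) - b) * Complex.I * θ) / (2 * Real.pi)), integral_angular]
  split_ifs with h
  · subst h
    rw [integral_complex_ofReal, integral_radial]
    simp
  · simp

section Gaussian

variable {d : ℕ}

/-- The point of `ℂ^d` with the given polar coordinates. -/
noncomputable def gaussPoint (ω : Fin d → ℝ × ℝ) : EuclideanSpace ℂ (Fin d) :=
  WithLp.toLp 2 fun i => polarPoint (ω i)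

/-- The Gaussian density on `ℂ^d` in polar coordinates. -/
noncomputable def gaussWeight (ω : Fin d → ℝ × ℝ) : ℝ := ∏ i, polarWeight (ω i)

/-- Lebesgue measure on the polar coordinates of `ℂ^d`. -/
noncomputable def gaussMeasure (d : ℕ) : MeasureTheory.Measure (Fin d → ℝ × ℝ) :=
  MeasureTheory.Measure.pi fun _ => polarMeasure

theorem gaussWeight_nonneg (ω : Fin d → ℝ × ℝ) : 0 ≤ gaussWeight ω :=
  Finset.prod_nonneg fun _ _ => div_nonneg (Real.exp_pos _).le Real.two_pi_pos.le

theorem gaussWeight_mul_eq (α β : Fin d →₀ ℕ) (ω : Fin d → ℝ × ℝ) :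
    (gaussWeight ω : ℂ) * ((∏ i, gaussPoint ω i ^ α i) * conj (∏ i, gaussPoint ω i ^ β i)) =
      ∏ i, (polarWeight (ω i) : ℂ) *
        (polarPoint (ω i) ^ α i * conj (polarPoint (ω i)) ^ β i) := by
  rw [gaussWeight, Finset.prod_mul_distrib, Finset.prod_mul_distrib, map_prod]
  push_cast
  simp only [map_pow]
  rfl

open MeasureTheory in
theorem integrable_gauss_moment (α β : Fin d →₀ ℕ) :
    Integrable (fun ω => (gaussWeight ω : ℂ) *
      ((∏ i, gaussPoint ω i ^ α i) * conj (∏ i, gaussPoint ω i ^ β i))) (gaussMeasure d) := by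
  simp only [gaussWeight_mul_eq]
  exact Integrable.fintype_prod fun i => integrable_polar_moment (α i) (β i)

open MeasureTheory in
theorem integral_gauss_moment (α β : Fin d →₀ ℕ) :
    ∫ ω, (gaussWeight ω : ℂ) *
      ((∏ i, gaussPoint ω i ^ α i) * conj (∏ i, gaussPoint ω i ^ β i)) ∂(gaussMeasure d) =
      if α = β then (multiFactorial α : ℂ) else 0 := by
  simp only [gaussWeight_mul_eq]
  rw [gaussMeasure, integral_fintype_prod_eq_prod (fun i x => (polarWeight x : ℂ) *
    (polarPoint x ^ α i * conj (polarPoint x) ^ β i))]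
  simp only [integral_polar_moment]
  split_ifs with h
  · subst h
    simp [multiFactorial]
  · obtain ⟨i, hi⟩ : ∃ i, α i ≠ β i := by
      by_contra! hc
      exact h (Finsupp.ext hc)
    exact Finset.prod_eq_zero (Finset.mem_univ i) (if_neg hi)

theorem gaussWeight_mul_norm_sq (f : MvPolynomial (Fin d) ℂ) (ω : Fin d → ℝ × ℝ) :
    ((gaussWeight ω * ‖evalAt (gaussPoint ω) f‖ ^ 2 : ℝ) : ℂ) =
      ∑ α ∈ f.support, ∑ β ∈ f.support, (coeff α f * conj (coeff β f)) *
        ((gaussWeight ω : ℂ) *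
          ((∏ i, gaussPoint ω i ^ α i) * conj (∏ i, gaussPoint ω i ^ β i))) := by
  push_cast
  rw [← Complex.mul_conj', evalAt, eval_eq', map_sum, Finset.sum_mul_sum, Finset.mul_sum]
  refine Finset.sum_congr rfl fun α _ => ?_
  rw [Finset.mul_sum]
  refine Finset.sum_congr rfl fun β _ => ?_
  rw [map_mul]
  ring

open MeasureTheory in
theorem integrable_gauss_norm_sq (f : MvPolynomial (Fin d) ℂ) :
    Integrable (fun ω => gaussWeight ω * ‖evalAt (gaussPoint ω) f‖ ^ 2) (gaussMeasure d) := by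
  have : Integrable (fun ω => ((gaussWeight ω * ‖evalAt (gaussPoint ω) f‖ ^ 2 : ℝ) : ℂ))
      (gaussMeasure d) := by
    simp only [gaussWeight_mul_norm_sq]
    exact integrable_finsetSum _ fun α _ => integrable_finsetSum _ fun β _ =>
      (integrable_gauss_moment α β).const_mul _
  exact this.re

open MeasureTheory in
theorem integral_gauss_norm_sq (f : MvPolynomial (Fin d) ℂ) :
    ∫ ω, gaussWeight ω * ‖evalAt (gaussPoint ω) f‖ ^ 2 ∂(gaussMeasure d) = apolarNorm f ^ 2 := by
  apply Complex.ofReal_injective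
  rw [← integral_complex_ofReal, apolarNorm_sq_ofReal]
  simp only [gaussWeight_mul_norm_sq]
  rw [integral_finsetSum _ fun α _ => integrable_finsetSum _ fun β _ =>
      (integrable_gauss_moment α β).const_mul _, apolarInner]
  refine Finset.sum_congr rfl fun α hα => ?_
  rw [integral_finsetSum _ fun β _ => (integrable_gauss_moment α β).const_mul _]
  simp only [integral_const_mul, integral_gauss_moment]
  simp [hα]
  ring

/-- By adjointness each term is `⟨f, ∂_i(z_i f)⟩`. The product rule gives `d` copies of `⟨f, f⟩`,
and Euler's identity gives `m` more. -/
theorem sum_apolarNorm_mul_X_sq {m : ℕ} {f : MvPolynomial (Fin d) ℂ} (hf : f.IsHomogeneous m) :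
    ∑ i, apolarNorm (f * X i) ^ 2 = ((m : ℝ) + d) * apolarNorm f ^ 2 := by
  apply Complex.ofReal_injective
  push_cast
  simp only [← Complex.ofReal_pow, apolarNorm_sq_ofReal, apolarInner_X_mul, pderiv_mul,
    pderiv_X_self, mul_one, apolarInner_add_right]
  rw [Finset.sum_add_distrib, ← apolarInner_sum_right]
  simp only [mul_comm (pderiv _ f)]
  rw [hf.sum_X_mul_pderiv, ← Nat.cast_smul_eq_nsmul ℂ, apolarInner_smul_right]
  simp
  ring

open MeasureTheory in
-- One factor `|z|² = ∑ |z_i|²` is absorbed by passing from `f` to the `z_i f`. These have degree `m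
-- + 1`, so the later factors only grow.
theorem pow_mul_apolarNorm_sq_le_integral (j : ℕ) {m : ℕ} {f : MvPolynomial (Fin d) ℂ}
    (hf : f.IsHomogeneous m) :
    Integrable (fun ω => ‖gaussPoint ω‖ ^ (2 * j) *
      (gaussWeight ω * ‖evalAt (gaussPoint ω) f‖ ^ 2)) (gaussMeasure d) ∧
    ((m : ℝ) + d) ^ j * apolarNorm f ^ 2 ≤ ∫ ω, ‖gaussPoint ω‖ ^ (2 * j) *
      (gaussWeight ω * ‖evalAt (gaussPoint ω) f‖ ^ 2) ∂(gaussMeasure d) := by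
  induction j generalizing m f with
  | zero => simp [integral_gauss_norm_sq, integrable_gauss_norm_sq]
  | succ j ih =>
    have hX : ∀ i, (f * X i).IsHomogeneous (m + 1) := fun i => hf.mul (isHomogeneous_X ℂ i)
    have e : ∀ ω : Fin d → ℝ × ℝ, ‖gaussPoint ω‖ ^ (2 * (j + 1)) *
        (gaussWeight ω * ‖evalAt (gaussPoint ω) f‖ ^ 2) = ∑ i, ‖gaussPoint ω‖ ^ (2 * j) *
        (gaussWeight ω * ‖evalAt (gaussPoint ω) (f * X i)‖ ^ 2) := by
      intro ω
      have : ∀ i, evalAt (gaussPoint ω) (f * X i) = evalAt (gaussPoint ω) f * gaussPoint ω i := by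
        intro i
        simp [evalAt]
      simp only [this, norm_mul, mul_pow]
      rw [← Finset.mul_sum, ← Finset.mul_sum, ← Finset.mul_sum, ← EuclideanSpace.norm_sq_eq]
      ring
    simp only [e]
    refine ⟨integrable_finsetSum _ fun i _ => (ih (hX i)).1, ?_⟩
    rw [integral_finsetSum _ fun i _ => (ih (hX i)).1]
    refine le_trans ?_ (Finset.sum_le_sum fun i _ => (ih (hX i)).2)
    rw [← Finset.mul_sum, sum_apolarNorm_mul_X_sq hf, pow_succ, mul_assoc]
    refine mul_le_mul_of_nonneg_right (pow_le_pow_left₀ (by positivity) ?_ _) (by positivity)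
    push_cast
    linarith

open MeasureTheory in
theorem mul_apolarNorm_sq_le_sum {ι : Type*} (s : Finset ι) (Q : ι → MvPolynomial (Fin d) ℂ)
    {j m : ℕ} {μ : ℝ}
    (hQ : ∀ z, μ ^ 2 * ‖z‖ ^ (2 * j) ≤ ∑ a ∈ s, ‖evalAt z (Q a)‖ ^ 2)
    {f : MvPolynomial (Fin d) ℂ} (hf : f.IsHomogeneous m) :
    μ ^ 2 * (((m : ℝ) + d) ^ j * apolarNorm f ^ 2) ≤ ∑ a ∈ s, apolarNorm (Q a * f) ^ 2 := by
  obtain ⟨h1, h2⟩ := pow_mul_apolarNorm_sq_le_integral j hf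
  refine (mul_le_mul_of_nonneg_left h2 (sq_nonneg μ)).trans ?_
  simp only [← integral_gauss_norm_sq]
  rw [← integral_const_mul, ← integral_finsetSum _ fun a _ => integrable_gauss_norm_sq _]
  refine integral_mono (h1.const_mul _)
    (integrable_finsetSum _ fun a _ => integrable_gauss_norm_sq _) fun ω => ?_
  have : ∀ a, evalAt (gaussPoint ω) (Q a * f) =
      evalAt (gaussPoint ω) (Q a) * evalAt (gaussPoint ω) f := fun a => by simp [evalAt]
  simp only [this, norm_mul, mul_pow]
  rw [← Finset.mul_sum, ← Finset.sum_mul]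
  have h := mul_le_mul_of_nonneg_right (hQ (gaussPoint ω))
    (mul_nonneg (gaussWeight_nonneg ω) (sq_nonneg ‖evalAt (gaussPoint ω) f‖))
  nlinarith [h]

end Gaussian

/-! ### The Khavinson–Shapiro exponent -/

section Exponent

variable {d : ℕ}

theorem evalAt_smul {Q : MvPolynomial (Fin d) ℂ} {n : ℕ} (hQ : Q.IsHomogeneous n) (a : ℂ)
    (z : EuclideanSpace ℂ (Fin d)) : evalAt (a • z) Q = a ^ n * evalAt z Q := by
  rw [evalAt, evalAt, eval_eq', eval_eq', Finset.mul_sum]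
  refine Finset.sum_congr rfl fun α hα => ?_
  have h : ∑ i, α i = n := by
    rw [← hQ (mem_support_iff.1 hα)]
    simp [Finsupp.weight_apply, Finsupp.sum_fintype]
  simp only [PiLp.smul_apply, smul_eq_mul, mul_pow, Finset.prod_mul_distrib,
    Finset.prod_pow_eq_pow_sum, h]
  ring

theorem isCommonZero_smul {P : MvPolynomial (Fin d) ℂ} {k ρ : ℕ} (hP : P.IsHomogeneous k)
    {c : EuclideanSpace ℂ (Fin d)} (h : IsCommonZero P ρ c) (a : ℂ) :
    IsCommonZero P ρ (a • c) := by
  intro α hα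
  rw [evalAt_smul (isHomogeneous_partialDeriv hP α), h α hα, mul_zero]

theorem continuous_derivSize (P : MvPolynomial (Fin d) ℂ) (ρ : ℕ) :
    Continuous (derivSize P ρ) := by
  have : ∀ Q : MvPolynomial (Fin d) ℂ,
      Continuous fun z : EuclideanSpace ℂ (Fin d) => evalAt z Q := fun Q =>
    (continuous_eval Q).comp (by fun_prop)
  unfold derivSize
  refine Real.continuous_sqrt.comp (continuous_finsetSum _ fun α _ => ?_)
  exact ((this _).norm).pow 2

theorem derivSize_pos {P : MvPolynomial (Fin d) ℂ} {ρ : ℕ} {z : EuclideanSpace ℂ (Fin d)}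
    (h : ¬ IsCommonZero P ρ z) : 0 < derivSize P ρ z := by
  unfold IsCommonZero at h
  push Not at h
  obtain ⟨α, hα, hne⟩ := h
  refine Real.sqrt_pos.2 (Finset.sum_pos' (fun _ _ => sq_nonneg _) ⟨α, hα, ?_⟩)
  have := norm_pos_iff.2 hne
  positivity

theorem sq_mul_norm_pow_le {P : MvPolynomial (Fin d) ℂ} {k ρ : ℕ} (hP : P.IsHomogeneous k)
    (hρ : ρ < k) {μ : ℝ} (hμ : 0 ≤ μ)
    (h : ∀ η : EuclideanSpace ℂ (Fin d), ‖η‖ = 1 → μ ≤ derivSize P ρ η)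
    (z : EuclideanSpace ℂ (Fin d)) :
    μ ^ 2 * ‖z‖ ^ (2 * (k - ρ)) ≤ ∑ α ∈ multiIndices d ρ, ‖evalAt z (partialDeriv α P)‖ ^ 2 := by
  rcases eq_or_ne z 0 with rfl | hz
  -- Here `ρ < k` matters: the exponent of `‖z‖` is positive.
  · rw [norm_zero, zero_pow (by omega), mul_zero]
    positivity
  have hz' : 0 < ‖z‖ := norm_pos_iff.2 hz
  have h1 : ‖((‖z‖ : ℂ)⁻¹) • z‖ = 1 := by
    rw [norm_smul, norm_inv, Complex.norm_real, norm_norm, inv_mul_cancel₀ hz'.ne']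
  have h2 := pow_le_pow_left₀ hμ (h _ h1) 2
  rw [derivSize, Real.sq_sqrt (by positivity)] at h2
  have h3 : ∀ α ∈ multiIndices d ρ, ‖evalAt (((‖z‖ : ℂ)⁻¹) • z) (partialDeriv α P)‖ ^ 2 =
      (‖z‖ ^ (2 * (k - ρ)))⁻¹ * ‖evalAt z (partialDeriv α P)‖ ^ 2 := by
    intro α hα
    have hh := isHomogeneous_partialDeriv hP α
    rw [mem_multiIndices.1 hα] at hh
    rw [evalAt_smul hh, norm_mul, norm_pow, norm_inv, Complex.norm_real, norm_norm, mul_pow,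
      inv_pow, inv_pow, ← pow_mul, mul_comm 2]
  rw [Finset.sum_congr rfl h3, ← Finset.mul_sum, inv_mul_eq_div, le_div_iff₀ (by positivity)] at h2
  exact h2

/-- The lower bound for `‖P f‖` in terms of a lower bound for the derivatives on the sphere. -/
theorem apolarNorm_mul_ge {P : MvPolynomial (Fin d) ℂ} {k ρ : ℕ} (hd : 1 ≤ d)
    (hP : P.IsHomogeneous k) (hρ : ρ < k) {μ : ℝ} (hμ : 0 ≤ μ)
    (h : ∀ η : EuclideanSpace ℂ (Fin d), ‖η‖ = 1 → μ ≤ derivSize P ρ η)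
    {m : ℕ} {f : MvPolynomial (Fin d) ℂ} (hf : f.IsHomogeneous m) :
    ((k : ℝ) ^ ρ)⁻¹ * (√((d + ρ - 1).choose ρ : ℝ))⁻¹ * μ *
      ((m : ℝ) + d) ^ (((k : ℝ) - ρ) / 2) * apolarNorm f ≤ apolarNorm (P * f) := by
  have hcard : (multiIndices d ρ).card = (d + ρ - 1).choose ρ := by
    rw [multiIndices, Finset.card_finsuppAntidiag_nat_eq_choose]
    simp
  have hB : 0 < ((d + ρ - 1).choose ρ : ℝ) := by
    exact_mod_cast Nat.choose_pos (by omega)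
  have hk : (1 : ℝ) ≤ (k : ℝ) ^ ρ := one_le_pow₀ (by exact_mod_cast (by omega : 1 ≤ k))
  have lower := mul_apolarNorm_sq_le_sum (multiIndices d ρ) (fun α => partialDeriv α P)
    (sq_mul_norm_pow_le hP hρ hμ h) hf
  have upper : ∑ α ∈ multiIndices d ρ, apolarNorm (partialDeriv α P * f) ^ 2 ≤
      ((d + ρ - 1).choose ρ : ℝ) * ((k : ℝ) ^ ρ * apolarNorm (P * f) ^ 2) := by
    rw [← hcard, ← nsmul_eq_mul]
    refine Finset.sum_le_card_nsmul _ _ _ fun α hα => ?_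
    have := apolarNorm_partialDeriv_mul_sq_le hP f α
    rwa [mem_multiIndices.1 hα] at this
  refine le_of_sq_le_sq ?_ (apolarNorm_nonneg _)
  have e : (((m : ℝ) + d) ^ (((k : ℝ) - ρ) / 2)) ^ 2 = ((m : ℝ) + d) ^ (k - ρ) := by
    rw [← Real.rpow_natCast, ← Real.rpow_mul (by positivity), ← Real.rpow_natCast,
      Nat.cast_sub hρ.le]
    congr 1
    push_cast
    ring
  have h1 := lower.trans upper
  -- The argument yields the constant with `k^(-ρ/2)`; the stated `k^(-ρ)` is weaker since `k ≥ 1`.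
  have h2 : ((d + ρ - 1).choose ρ : ℝ) * ((k : ℝ) ^ ρ * apolarNorm (P * f) ^ 2) ≤
      ((d + ρ - 1).choose ρ : ℝ) * (((k : ℝ) ^ ρ) ^ 2 * apolarNorm (P * f) ^ 2) := by
    gcongr
    exact le_self_pow₀ hk two_ne_zero
  rw [mul_pow, mul_pow, mul_pow, mul_pow, e, inv_pow, inv_pow, Real.sq_sqrt hB.le]
  have hk' : (0 : ℝ) < (k : ℝ) ^ ρ := by linarith
  have h3 : (((k : ℝ) ^ ρ) ^ 2)⁻¹ * (((d + ρ - 1).choose ρ : ℝ))⁻¹ * μ ^ 2 *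
      ((m : ℝ) + d) ^ (k - ρ) * apolarNorm f ^ 2 =
      (μ ^ 2 * (((m : ℝ) + d) ^ (k - ρ) * apolarNorm f ^ 2)) /
        (((d + ρ - 1).choose ρ : ℝ) * ((k : ℝ) ^ ρ) ^ 2) := by
    field_simp
  rw [h3, div_le_iff₀ (by positivity)]
  refine (h1.trans h2).trans (le_of_eq ?_)
  ring

theorem le_of_rpow_le {k : ℕ} {K C a b : ℝ} (hK : 0 < K)
    (h : ∀ m : ℕ, k ≤ m → K * (m : ℝ) ^ (a / 2) ≤ C * (m : ℝ) ^ (b / 2)) : a ≤ b := by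
  by_contra! hab
  have ht : Filter.Tendsto (fun m : ℕ => ((m : ℝ)) ^ ((a - b) / 2)) Filter.atTop Filter.atTop :=
    (tendsto_rpow_atTop (by linarith)).comp tendsto_natCast_atTop_atTop
  obtain ⟨m, hm, hmk, hm1⟩ := ((ht.eventually_gt_atTop (C / K)).and
    ((Filter.eventually_ge_atTop k).and (Filter.eventually_ge_atTop 1))).exists
  have hm0 : (0 : ℝ) < m := by exact_mod_cast hm1
  have h1 := h m hmk
  have h2 : (m : ℝ) ^ (a / 2) = (m : ℝ) ^ ((a - b) / 2) * (m : ℝ) ^ (b / 2) := by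
    rw [← Real.rpow_add hm0]
    congr 1
    ring
  rw [h2, ← mul_assoc] at h1
  have h3 := le_of_mul_le_mul_right h1 (Real.rpow_pos_of_pos hm0 _)
  rw [div_lt_iff₀ hK] at hm
  linarith

theorem isHomogeneous_innerPoly (c : EuclideanSpace ℂ (Fin d)) :
    (innerPoly c).IsHomogeneous 1 :=
  IsHomogeneous.sum _ _ _ fun _ _ => isHomogeneous_C_mul_X _ _

/-- Testing the bound on `⟨z, c⟩^m` compares the growth `m^(l/2)` with `m^((k-s)/2)`. With `s = 0`
no vanishing is required, which gives `l ≤ k`. -/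
theorem khavinsonShapiroBound_le {P : MvPolynomial (Fin d) ℂ} {k l s : ℕ}
    (hP : P.IsHomogeneous k) (hs : s ≤ k) {c : EuclideanSpace ℂ (Fin d)}
    (hc : ‖c‖ = 1) (h : ∀ j < s, IsCommonZero P j c) (hl : KhavinsonShapiroBound P l) :
    l + s ≤ k := by
  obtain ⟨K, hK, hl⟩ := hl
  -- The threshold `k + 1` ensures `m ≥ 1` even when `k = 0`.
  have key := le_of_rpow_le (k := k + 1) hK (a := l) (b := (k : ℝ) - s) (C := _) fun m hm => by
    have h1 := hl m (innerPoly c ^ m) (by simpa using (isHomogeneous_innerPoly c).pow m)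
    have h2 := apolarNorm_mul_innerPoly_pow_le hP (by omega) (by omega) hs hc h (m := m)
    have hpos : 0 < apolarNorm (innerPoly c ^ m) := by
      have h4 := apolarNorm_innerPoly_pow_sq hc m
      have h5 := apolarNorm_nonneg (innerPoly c ^ m)
      refine lt_of_le_of_ne h5 fun h6 => ?_
      rw [← h6] at h4
      have := Nat.factorial_pos m
      norm_num at h4
      exact this.ne (by exact_mod_cast h4)
    exact le_of_mul_le_mul_right (h1.trans h2) hpos
  have : ((l + s : ℕ) : ℝ) ≤ k := by push_cast; linarith
  exact_mod_cast this

theorem exists_isKhavinsonShapiroExponent {P : MvPolynomial (Fin d) ℂ} {k : ℕ} (hd : 1 ≤ d)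
    (hP0 : P ≠ 0) (hP : P.IsHomogeneous k) : ∃ l, IsKhavinsonShapiroExponent P l := by
  have hc : ‖(EuclideanSpace.single (⟨0, hd⟩ : Fin d) (1 : ℂ))‖ = 1 := by simp
  have hbdd : BddAbove {l : ℕ | KhavinsonShapiroBound P l} :=
    ⟨k, fun l hl => khavinsonShapiroBound_le hP (Nat.zero_le k) hc (by simp) hl⟩
  have hne : {l : ℕ | KhavinsonShapiroBound P l}.Nonempty := by
    refine ⟨0, apolarNorm P, apolarNorm_pos hP0, fun m q _ => ?_⟩
    simpa using apolarNorm_mul_apolarNorm_le hP q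
  exact ⟨_, Nat.sSup_mem hne hbdd, fun l hl => le_csSup hbdd hl⟩

theorem exists_isLeast_derivSize (hd : 1 ≤ d) (P : MvPolynomial (Fin d) ℂ) (ρ : ℕ) :
    ∃ μ, IsLeast (derivSize P ρ '' Metric.sphere (0 : EuclideanSpace ℂ (Fin d)) 1) μ := by
  have hne : (Metric.sphere (0 : EuclideanSpace ℂ (Fin d)) 1).Nonempty :=
    ⟨EuclideanSpace.single ⟨0, hd⟩ 1, by simp⟩
  exact ((isCompact_sphere _ _).image (continuous_derivSize P ρ)).exists_isLeast (hne.image _)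

end Exponent

theorem theorem1 (d k ρ : ℕ) (hk : 2 ≤ k) (hρ : 1 ≤ ρ) (hρk : ρ < k)
    (P : MvPolynomial (Fin d) ℂ) (hP0 : P ≠ 0) (hP : P.IsHomogeneous k) :
    ((¬ ∃ c : EuclideanSpace ℂ (Fin d), c ≠ 0 ∧ IsCommonZero P ρ c) →
      ∃ μ C₁ : ℝ,
        IsLeast (derivSize P ρ '' Metric.sphere (0 : EuclideanSpace ℂ (Fin d)) 1) μ ∧
        C₁ = ((k : ℝ) ^ ρ)⁻¹ * (√((d + ρ - 1).choose ρ : ℝ))⁻¹ * μ ∧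
        0 < C₁ ∧
        ∀ (m : ℕ) (f : MvPolynomial (Fin d) ℂ), f.IsHomogeneous m →
          C₁ * ((m : ℝ) + d) ^ (((k : ℝ) - ρ) / 2) * apolarNorm f ≤ apolarNorm (P * f)) ∧
    (∀ c : EuclideanSpace ℂ (Fin d), ‖c‖ = 1 → IsCommonZero P ρ c →
      ∀ m : ℕ, k ≤ m →
        apolarNorm (P * innerPoly c ^ m) ≤
          upperConst P k ρ c * (m : ℝ) ^ (((k : ℝ) - ρ - 1) / 2) *
            apolarNorm (innerPoly c ^ m)) ∧
    (∃ l : ℕ, IsKhavinsonShapiroExponent P l ∧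
      (k - ρ ≤ l ↔ ¬ ∃ c : EuclideanSpace ℂ (Fin d), c ≠ 0 ∧ IsCommonZero P ρ c)) := by
  -- In no variables every polynomial is constant, which excludes a nonzero form of degree `k ≥ 2`;
  -- hence the sphere is nonempty.
  have hd : 1 ≤ d := by
    rcases Nat.eq_zero_or_pos d with rfl | h
    · have h0 := hP.totalDegree hP0
      rw [eq_C_of_isEmpty P, totalDegree_C] at h0
      omega
    · exact h
  have part1 : (¬ ∃ c : EuclideanSpace ℂ (Fin d), c ≠ 0 ∧ IsCommonZero P ρ c) →
      ∃ μ C₁ : ℝ,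
        IsLeast (derivSize P ρ '' Metric.sphere (0 : EuclideanSpace ℂ (Fin d)) 1) μ ∧
        C₁ = ((k : ℝ) ^ ρ)⁻¹ * (√((d + ρ - 1).choose ρ : ℝ))⁻¹ * μ ∧
        0 < C₁ ∧
        ∀ (m : ℕ) (f : MvPolynomial (Fin d) ℂ), f.IsHomogeneous m →
          C₁ * ((m : ℝ) + d) ^ (((k : ℝ) - ρ) / 2) * apolarNorm f ≤ apolarNorm (P * f) := by
    intro hno
    obtain ⟨μ, hμ⟩ := exists_isLeast_derivSize hd P ρ
    have hpos : 0 < μ := by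
      obtain ⟨η, hη, rfl⟩ := hμ.1
      refine derivSize_pos fun h => hno ⟨η, ?_, h⟩
      rintro rfl
      simp at hη
    refine ⟨μ, _, hμ, rfl, ?_, fun m f hf => apolarNorm_mul_ge hd hP hρk hpos.le
      (fun η hη => hμ.2 ⟨η, by simpa using hη, rfl⟩) hf⟩
    have h1 : 0 < ((d + ρ - 1).choose ρ : ℝ) := by
      exact_mod_cast Nat.choose_pos (by omega)
    have h2 : (0 : ℝ) < k := by exact_mod_cast (by omega : 0 < k)
    positivity
  have order : ∀ {c : EuclideanSpace ℂ (Fin d)}, IsCommonZero P ρ c →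
      ∀ j < ρ + 1, IsCommonZero P j c := fun h j hj =>
    evalAt_eq_zero_of_partialDeriv hP hρk.le h (Nat.lt_succ_iff.1 hj)
  refine ⟨part1, ?_, ?_⟩
  · intro c hc h m hm
    have := apolarNorm_mul_innerPoly_pow_le hP hm (by omega) (show ρ + 1 ≤ k by omega) hc (order h)
    rw [show Finset.Ico (ρ + 1) (k + 1) = Finset.Ioc ρ k by ext; simp] at this
    rw [upperConst, sub_sub]
    exact_mod_cast this
  · obtain ⟨l, hl⟩ := exists_isKhavinsonShapiroExponent hd hP0 hP
    refine ⟨l, hl, ?_, ?_⟩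
    · rintro hle ⟨c, hc, h⟩
      have hn : ‖((‖c‖ : ℂ)⁻¹) • c‖ = 1 := by
        rw [norm_smul, norm_inv, Complex.norm_real, norm_norm,
          inv_mul_cancel₀ (norm_ne_zero_iff.2 hc)]
      have := khavinsonShapiroBound_le hP (show ρ + 1 ≤ k by omega) hn
        (order (isCommonZero_smul hP h _)) hl.1
      omega
    · intro hno
      obtain ⟨μ, C₁, -, -, hpos, hb⟩ := part1 hno
      -- `C₁` serves as `K`, because `m ≤ m + d` and the exponent is nonnegative.
      refine hl.2 ⟨C₁, hpos, fun m q hq => le_trans ?_ (hb m q hq)⟩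
      refine mul_le_mul_of_nonneg_right (mul_le_mul_of_nonneg_left ?_ hpos.le)
        (apolarNorm_nonneg q)
      rw [Nat.cast_sub hρk.le]
      have : (ρ : ℝ) < k := by exact_mod_cast hρk
      exact Real.rpow_le_rpow (by positivity) (by simp) (by linarith)
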